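/- Let $\Gamma$ be a finite digraph without loops and without multiple arcs, with vertices $1,\dots,n$ and at least one arc, all of whose arcs have unit weight. Let $L=(\ell_{ij})$ be its Kirchhoff matrix: for $j\ne i$, $\ell_{ij}=-1$ if $(j,i)$ is an arc and $\ell_{ij}=0$ otherwise, and $\ell_{ii}=-\sum_{k\ne i}\ell_{ik}$. A spanning diverging forest of $\Gamma$ is a spanning subgraph without circuits in which every vertex has indegree at most $1$; its roots are the vertices of indegree $0$, and a vertex belongs to the tree diverging from the root $j$ if it is reachable from $j$ in the forest. A maximum out forest is a spanning diverging forest with the greatest possible number of arcs. Let $\bar J=(\bar J_{ij})$ be the normalized matrix of maximum out forests: $\bar J_{ij}$ is the number of maximum out forests of $\Gamma$ in which $i$ belongs to a tree diverging from $j$, divided by the number of all maximum out forests of $\Gamma$. Let $\varepsilon(\mathcal F)$ be the total weight of the set $\mathcal F$ of all spanning diverging forests of $\Gamma$, which is here the number of these forests. Then $\varepsilon(\mathcal F)=\det(I+L)$, the matrix $I+\varepsilon^2(\mathcal F)L$ is invertible, and the entries of $(I+\varepsilon^2(\mathcal F)L)^{-1}$ that exceed $\varepsilon^{-1}(\mathcal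 F)$ occupy exactly the positions of the nonzero entries of $\bar J$: for all $i,j$, $$\bigl((I+\varepsilon^2(\mathcal F)L)^{-1}\bigr)_{ij}>\frac1{\varepsilon(\mathcal F)}\iff \bar J_{ij}\neq 0.$$ -/

import Mathlib

/-- A weighted digraph without loops on the vertex set `V`, given by its matrix of arc weights:
`weight i j` is the weight of the arc `(i, j)`, which is strictly positive when there is an arc from
`i` to `j`, and `0` when there is none. -/
structure WeightedDigraph (V : Type*) where
  weight : V → V → ℝ
  weight_nonneg : ∀ i j, 0 ≤ weight i j
  weight_self : ∀ i, weight i i = 0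

/-! Spanning subgraphs are given by their sets of arcs, since their vertex set is all of `V`. -/
namespace ArcSet

variable {V : Type*}

/-- The indegree of the vertex `w`: the number of arcs that come in `w`. -/
def indegree [DecidableEq V] (F : Finset (V × V)) (w : V) : ℕ :=
  (F.filter (fun e => e.2 = w)).card

/-- `j` is reachable from `i` along the arcs of `F` (or `i = j`). -/
def Reachable (F : Finset (V × V)) (i j : V) : Prop :=
  Relation.ReflTransGen (fun a b => (a, b) ∈ F) i j

/-- There is no circuit: no route with at least one arc leads from a vertex to itself. -/
def NoCircuits (F : Finset (V × V)) : Prop :=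
  ∀ w : V, ¬ Relation.TransGen (fun a b => (a, b) ∈ F) w w

/-- A diverging forest: no circuits, and every vertex has indegree at most one. -/
def IsDivergingForest [DecidableEq V] (F : Finset (V × V)) : Prop :=
  NoCircuits F ∧ ∀ w : V, indegree F w ≤ 1

/-- A root: a vertex of indegree zero. -/
def IsRoot [DecidableEq V] (F : Finset (V × V)) (w : V) : Prop :=
  indegree F w = 0

/-- In the diverging forest `F`, the vertex `i` belongs to a tree diverging from `j`. -/
def InTreeDivergingFrom [DecidableEq V] (F : Finset (V × V)) (j i : V) : Prop :=
  IsRoot F j ∧ Reachable F j i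

end ArcSet

namespace WeightedDigraph

variable {V : Type*}

/-- There is an arc from `i` to `j`. -/
def IsArc (G : WeightedDigraph V) (i j : V) : Prop := G.weight i j ≠ 0

/-- The Kirchhoff matrix `L`: `L i j = - weight j i` for `j ≠ i`, and
`L i i = - ∑ k ≠ i, L i k = ∑ k ≠ i, weight k i`. -/
def kirchhoff [Fintype V] [DecidableEq V] (G : WeightedDigraph V) : Matrix V V ℝ :=
  Matrix.of fun i j =>
    if j = i then ∑ k ∈ Finset.univ.erase i, G.weight k i else - G.weight j i

open Classical in
/-- The set of arcs. -/
noncomputable def arcs [Fintype V] (G : WeightedDigraph V) : Finset (V × V) :=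
  Finset.univ.filter (fun e => G.IsArc e.1 e.2)

/-- The weight of a spanning subgraph: the product of the weights of its arcs. -/
def subgraphWeight (G : WeightedDigraph V) (F : Finset (V × V)) : ℝ :=
  ∏ e ∈ F, G.weight e.1 e.2

/-- The weight of a set of spanning subgraphs: the sum of their weights. -/
def totalWeight (G : WeightedDigraph V) (S : Finset (Finset (V × V))) : ℝ :=
  ∑ F ∈ S, G.subgraphWeight F

open Classical in
/-- The set of all spanning diverging forests. -/
noncomputable def forests [Fintype V] [DecidableEq V] (G : WeightedDigraph V) :
    Finset (Finset (V × V)) :=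
  G.arcs.powerset.filter (fun F => ArcSet.IsDivergingForest F)

open Classical in
/-- The set of all maximum out forests: the spanning diverging forests with the greatest possible
number of arcs. -/
noncomputable def maxOutForests [Fintype V] [DecidableEq V] (G : WeightedDigraph V) :
    Finset (Finset (V × V)) :=
  G.forests.filter (fun F => ∀ F' ∈ G.forests, F'.card ≤ F.card)

open Classical in
/-- The matrix of maximum out forests: its `(i, j)` entry is the weight of the set of all maximum
out forests in which `i` belongs to a tree diverging from `j`. -/
noncomputable def maxOutForestMatrix [Fintype V] [DecidableEq V] (G : WeightedDigraph V) :
    Matrix V V ℝ :=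
  Matrix.of fun i j =>
    G.totalWeight (G.maxOutForests.filter (fun F => ArcSet.InTreeDivergingFrom F j i))

/-- The normalized matrix of maximum out forests. -/
noncomputable def normalizedMaxOutForestMatrix [Fintype V] [DecidableEq V]
    (G : WeightedDigraph V) : Matrix V V ℝ :=
  (G.totalWeight G.maxOutForests)⁻¹ • G.maxOutForestMatrix

end WeightedDigraph

/-! By the matrix forest theorem, with unit weights and `t > 0`, `det (1 + tL)` is the sum of `t ^
|F|` over all forests `F`, and the `(i, j)` entry of the adjugate is the same sum over the forests
where `i` lies in the tree diverging from `j`. Let `N` be the number of forests, `m` the maximal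
number of arcs and `t = N ^ 2`. If no maximum forest puts `i` under `j`, the numerator is at most `N
* t ^ (m - 1) = t ^ m / N`, so the entry is at most `1 / N`. Otherwise the numerator is at least `t
^ m`, while the determinant is less than `N * t ^ m`.

The matrix forest theorem (`det_one_add_kirchhoff`, `adjugate_one_add_kirchhoff`) comes from
multilinearity in the rows: each vertex chooses a parent or becomes a root, and `det_matrix`,
`adjugate_matrix` evaluate the resulting 0/1 terms. -/

namespace ParentMap

/-! ### Parent maps and their determinants -/

variable {V : Type*} [Fintype V] [DecidableEq V]

/-- The arc set of a partial parent map. -/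
def arcSet (g : V → Option V) : Finset (V × V) :=
  Finset.univ.filter fun e => g e.2 = some e.1

@[simp] lemma mem_arcSet {g : V → Option V} {a b : V} : (a, b) ∈ arcSet g ↔ g b = some a := by
  simp [arcSet]

lemma indegree_arcSet_le_one (g : V → Option V) (w : V) :
    ArcSet.indegree (arcSet g) w ≤ 1 := by
  unfold ArcSet.indegree
  rw [Finset.card_le_one]
  rintro ⟨a, b⟩ h ⟨c, d⟩ h'
  simp only [Finset.mem_filter, mem_arcSet] at h h'
  obtain ⟨h, rfl⟩ := h
  obtain ⟨h', rfl⟩ := h'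
  simp_all

lemma isRoot_arcSet {g : V → Option V} {j : V} : ArcSet.IsRoot (arcSet g) j ↔ g j = none := by
  unfold ArcSet.IsRoot ArcSet.indegree
  rw [Finset.card_eq_zero, Finset.filter_eq_empty_iff]
  constructor
  · intro h
    rw [Option.eq_none_iff_forall_ne_some]
    intro a ha
    exact h (mem_arcSet.2 ha) rfl
  · rintro h ⟨a, b⟩ hab rfl
    simp only [mem_arcSet] at hab
    simp_all

lemma arcSet_injective : Function.Injective (arcSet : (V → Option V) → Finset (V × V)) := by
  intro g g' h
  funext i
  ext a
  have := congrArg (fun F => (a, i) ∈ F) h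
  simpa using this

lemma exists_arcSet_eq {F : Finset (V × V)} (hF : ∀ w, ArcSet.indegree F w ≤ 1) :
    ∃ g : V → Option V, arcSet g = F := by
  classical
  refine ⟨fun i => if h : ∃ a, (a, i) ∈ F then some h.choose else none, ?_⟩
  ext ⟨a, b⟩
  rw [mem_arcSet]
  constructor
  · intro h
    split_ifs at h with h'
    have := h'.choose_spec
    rwa [Option.some.inj h] at this
  · intro h
    have h' : ∃ a, (a, b) ∈ F := ⟨a, h⟩
    rw [dif_pos h']
    have := Finset.card_le_one.1 (hF b) (h'.choose, b) (by simp [h'.choose_spec]) (a, b)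
      (by simp [h])
    simpa using this

/-- Descendants of `j` are closed under passing between a vertex and its parent. -/
lemma reachable_iff_parent {g : V → Option V} {i j k : V} (hi : g i = some k) (hj : i ≠ j) :
    ArcSet.Reachable (arcSet g) j i ↔ ArcSet.Reachable (arcSet g) j k := by
  constructor
  · intro h
    rcases Relation.ReflTransGen.cases_tail h with h | ⟨c, hc, hci⟩
    · exact absurd h hj
    · rw [mem_arcSet, hi] at hci
      cases hci
      exact hc
  · intro h
    exact Relation.ReflTransGen.tail h (mem_arcSet.2 hi)

lemma reachable_root_iff {g : V → Option V} {i j : V} (hi : g i = none) :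
    ArcSet.Reachable (arcSet g) j i ↔ i = j := by
  constructor
  · intro h
    rcases Relation.ReflTransGen.cases_tail h with h | ⟨c, hc, hci⟩
    · exact h
    · rw [mem_arcSet, hi] at hci
      cases hci
  · rintro rfl
    exact Relation.ReflTransGen.refl

/-- The vertex `i` descends from a root. -/
def Rooted (g : V → Option V) (i : V) : Prop :=
  ∃ r, g r = none ∧ ArcSet.Reachable (arcSet g) r i

lemma rooted_iff_parent {g : V → Option V} {i k : V} (hi : g i = some k) :
    Rooted g i ↔ Rooted g k := by
  refine exists_congr fun r => and_congr_right fun hr => reachable_iff_parent hi ?_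
  rintro rfl
  simp_all

/-- Parents are unique, so a circuit through a vertex also passes through its parent. Climbing to
the root would give the root an incoming arc. -/
lemma noCircuits_of_rooted {g : V → Option V} (h : ∀ i, Rooted g i) :
    ArcSet.NoCircuits (arcSet g) := by
  intro w hw
  obtain ⟨r, hr, hrw⟩ := h w
  have : Relation.TransGen (fun a b => (a, b) ∈ arcSet g) r r := by
    clear h
    induction hrw with
    | refl => exact hw
    | @tail b c _ hbc ih =>
      apply ih
      rw [Relation.TransGen.tail'_iff] at hw
      obtain ⟨d, hcd, hdc⟩ := hw
      rw [mem_arcSet] at hbc hdc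
      have : d = b := by simp_all
      subst this
      exact Relation.TransGen.head' (mem_arcSet.2 hbc) hcd
  rw [Relation.TransGen.tail'_iff] at this
  obtain ⟨d, -, hd⟩ := this
  rw [mem_arcSet, hr] at hd
  cases hd

/-- The row of the vertex `i` with parent choice `o`. -/
def row (i : V) (o : Option V) : V → ℝ :=
  Pi.single i 1 - o.elim 0 fun k => Pi.single k 1

/-- The Kirchhoff matrix of a parent map, with `1` added at the roots. -/
def matrix (g : V → Option V) : Matrix V V ℝ := Matrix.of fun i => row i (g i)

lemma matrix_mulVec_of_none {g : V → Option V} {i : V} (h : g i = none) (x : V → ℝ) :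
    (matrix g).mulVec x i = x i := by
  simp [Matrix.mulVec, matrix, row, h]

lemma matrix_mulVec_of_some {g : V → Option V} {i k : V} (h : g i = some k) (x : V → ℝ) :
    (matrix g).mulVec x i = x i - x k := by
  change (Pi.single i 1 - (g i).elim 0 fun k => Pi.single k 1) ⬝ᵥ x = _
  rw [h, sub_dotProduct]
  simp

lemma det_matrix_of_noCircuits {g : V → Option V} (h : ArcSet.NoCircuits (arcSet g)) :
    (matrix g).det = 1 := by
  classical
  let R : V → V → Prop := Relation.TransGen fun a b => (a, b) ∈ arcSet g
  -- Vertices are ordered by their number of proper ancestors, reversed so that a parent comes after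
  -- its child and the matrix is upper unitriangular.
  let b : V → ℕᵒᵈ := fun i => OrderDual.toDual (Finset.univ.filter fun a => R a i).card
  have hb : ∀ i k, g i = some k → b i < b k := by
    intro i k hik
    refine OrderDual.toDual_lt_toDual.2 (Finset.card_lt_card ?_)
    have hki : R k i := Relation.TransGen.single (mem_arcSet.2 hik)
    rw [Finset.ssubset_iff_of_subset]
    · exact ⟨k, by simpa using hki, fun hk => h k (Finset.mem_filter.1 hk).2⟩
    · intro a ha
      simp only [Finset.mem_filter, Finset.mem_univ, true_and] at ha ⊢
      exact Relation.TransGen.trans ha hki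
  have key : ∀ i k, b k ≤ b i → matrix g i k = (1 : Matrix V V ℝ) i k := by
    intro i k hik
    rcases hg : g i with _ | l
    · simp [matrix, row, hg, Matrix.one_apply, Pi.single_apply, eq_comm]
    · have : k ≠ l := by
        rintro rfl
        exact absurd (hb i k hg) (not_lt.2 hik)
      simp [matrix, row, hg, Matrix.one_apply, Pi.single_apply, this, eq_comm]
  have htri : (matrix g).BlockTriangular b := by
    intro i k hik
    rw [key i k hik.le, Matrix.one_apply_ne]
    rintro rfl
    exact lt_irrefl _ hik
  rw [htri.det]
  refine Finset.prod_eq_one fun a _ => ?_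
  have : (matrix g).toSquareBlock b a = 1 := by
    ext ⟨i, hi⟩ ⟨k, hk⟩
    rw [Matrix.toSquareBlock_def, Matrix.of_apply, key i k (by rw [hi, hk])]
    simp [Matrix.one_apply]
  rw [this, Matrix.det_one]

open Classical in
/-- The indicator of the vertices that descend from no root. -/
noncomputable def unrooted (g : V → Option V) (i : V) : ℝ := if Rooted g i then 0 else 1

lemma unrooted_ne_zero {g : V → Option V} (h : ¬ ArcSet.NoCircuits (arcSet g)) :
    unrooted g ≠ 0 := by
  intro h0
  refine h (noCircuits_of_rooted fun i => ?_)
  by_contra hi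
  simpa [unrooted, hi] using congrFun h0 i

/-- A vertex and its parent are both rooted or both unrooted, and roots are rooted. With a circuit
present, this kernel vector is nonzero and the determinant vanishes. -/
lemma matrix_mulVec_unrooted (g : V → Option V) : (matrix g).mulVec (unrooted g) = 0 := by
  funext i
  rcases hg : g i with _ | k
  · have : Rooted g i := ⟨i, hg, Relation.ReflTransGen.refl⟩
    simp [matrix_mulVec_of_none hg, unrooted, this]
  · have := rooted_iff_parent hg
    by_cases hk : Rooted g k <;> simp_all [matrix_mulVec_of_some hg, unrooted]

open Classical in
lemma det_matrix (g : V → Option V) :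
    (matrix g).det = if ArcSet.NoCircuits (arcSet g) then 1 else 0 := by
  split_ifs with h
  · exact det_matrix_of_noCircuits h
  · exact Matrix.exists_mulVec_eq_zero_iff.1
      ⟨unrooted g, unrooted_ne_zero h, matrix_mulVec_unrooted g⟩

-- The indicator `u` of the descendants of `j` is mapped to the `j`-th basis vector, so without
-- circuits it is column `j` of the inverse.
open Classical in
lemma adjugate_matrix {g : V → Option V} {j : V} (hj : g j = none) (i : V) :
    (matrix g).adjugate i j =
      if ArcSet.NoCircuits (arcSet g) ∧ ArcSet.Reachable (arcSet g) j i then 1 else 0 := by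
  let u : V → ℝ := fun k => if ArcSet.Reachable (arcSet g) j k then 1 else 0
  have hu : (matrix g).mulVec u = Pi.single j 1 := by
    funext k
    rcases hg : g k with _ | l
    · simp [matrix_mulVec_of_none hg, u, reachable_root_iff hg, Pi.single_apply]
    · have hk : k ≠ j := by
        rintro rfl
        simp_all
      simp [matrix_mulVec_of_some hg, u, reachable_iff_parent hg hk, hk]
  -- Such an `x` is killed by the matrix whose row `j` is replaced by the `i`-th basis vector. It is
  -- applied to `unrooted g` if there is a circuit and `i` descends from `j`, and to `u` if `i` does
  -- not descend from `j`.
  have hker : ∀ x : V → ℝ, x ≠ 0 → (∀ k, k ≠ j → (matrix g).mulVec x k = 0) → x i = 0 →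
      (matrix g).adjugate i j = 0 := by
    intro x hx hxk hxi
    rw [Matrix.adjugate_apply]
    refine Matrix.exists_mulVec_eq_zero_iff.1 ⟨x, hx, ?_⟩
    funext k
    by_cases hk : k = j
    · subst hk
      simp [Matrix.mulVec, hxi]
    · simpa [Matrix.mulVec, Matrix.updateRow_ne hk] using hxk k hk
  by_cases hi : ArcSet.Reachable (arcSet g) j i
  · by_cases hc : ArcSet.NoCircuits (arcSet g)
    · have h1 : (matrix g).adjugate.mulVec ((matrix g).mulVec u) = u := by
        rw [Matrix.mulVec_mulVec, Matrix.adjugate_mul, det_matrix_of_noCircuits hc, one_smul,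
          Matrix.one_mulVec]
      rw [hu] at h1
      simpa [hi, hc, u] using congrFun h1 i
    · have : Rooted g i := ⟨j, hj, hi⟩
      rw [if_neg (by tauto)]
      exact hker _ (unrooted_ne_zero hc) (fun k _ => congrFun (matrix_mulVec_unrooted g) k)
        (by simp [unrooted, this])
  · rw [if_neg (by tauto)]
    refine hker u ?_ (fun k hk => by simp [hu, hk]) (by simp [u, hi])
    intro h
    have : ArcSet.Reachable (arcSet g) j j := Relation.ReflTransGen.refl
    simpa [u, this] using congrFun h j

end ParentMap

/-! ### The matrix forest theorem -/

namespace WeightedDigraph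

variable {V : Type*} [Fintype V] [DecidableEq V]

/-- The weight of choosing the parent `o` for the vertex `i`. -/
def parentWeight (G : WeightedDigraph V) (i : V) (o : Option V) : ℝ :=
  o.elim 1 fun k => G.weight k i

lemma prod_parentWeight (G : WeightedDigraph V) (g : V → Option V) :
    ∏ i, G.parentWeight i (g i) = G.subgraphWeight (ParentMap.arcSet g) := by
  rw [subgraphWeight, ParentMap.arcSet, Finset.prod_filter, Fintype.prod_prod_type_right]
  refine Finset.prod_congr rfl fun i _ => ?_
  rcases hg : g i with _ | k <;> simp [parentWeight, hg]

/-- The choice `none` accounts for the identity matrix and `some k` for the arc `(k, i)`; `row i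
(some i)` is zero. -/
lemma one_add_kirchhoff_row (G : WeightedDigraph V) (i : V) :
    (1 + G.kirchhoff) i = ∑ o, G.parentWeight i o • ParentMap.row i o := by
  funext j
  rw [Fintype.sum_option]
  simp only [parentWeight, ParentMap.row, kirchhoff, Matrix.add_apply, Matrix.one_apply,
    Matrix.of_apply, Pi.add_apply, Finset.sum_apply, Pi.smul_apply, Pi.sub_apply, smul_eq_mul,
    Option.elim, Pi.single_apply, mul_sub, Finset.sum_sub_distrib, Pi.zero_apply]
  by_cases h : j = i
  · subst h
    simp [← Finset.sum_erase_eq_sub]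
  · have h' : i ≠ j := fun e => h e.symm
    simp [h, h']

lemma mem_arcs {V : Type*} [Fintype V] (G : WeightedDigraph V) (e : V × V) :
    e ∈ G.arcs ↔ G.weight e.1 e.2 ≠ 0 := by
  classical
  rw [arcs, Finset.mem_filter]
  exact and_iff_right (Finset.mem_univ e)

lemma subgraphWeight_eq_zero {V : Type*} [Fintype V] (G : WeightedDigraph V)
    {F : Finset (V × V)} (h : ¬ F ⊆ G.arcs) :
    G.subgraphWeight F = 0 := by
  obtain ⟨e, he, he'⟩ := Finset.not_subset.1 h
  exact Finset.prod_eq_zero he (by simpa [mem_arcs] using he')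

-- Parent maps correspond to arc sets of indegree at most one; those using a pair that is not an arc
-- have weight zero.
open Classical in
lemma sum_parentWeight (G : WeightedDigraph V) (P : Finset (V × V) → Prop) :
    ∑ g : V → Option V, (∏ i, G.parentWeight i (g i)) *
        (if ArcSet.NoCircuits (ParentMap.arcSet g) ∧ P (ParentMap.arcSet g) then 1 else 0) =
      G.totalWeight (G.forests.filter P) := by
  simp only [prod_parentWeight, mul_ite, mul_one, mul_zero]
  rw [← Finset.sum_filter, totalWeight]
  refine Finset.sum_bij_ne_zero (fun g _ _ => ParentMap.arcSet g) ?_ ?_ ?_ ?_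
  · intro g hg hw
    simp only [Finset.mem_filter, Finset.mem_univ, true_and] at hg
    have : ParentMap.arcSet g ⊆ G.arcs := by
      by_contra h
      exact hw (G.subgraphWeight_eq_zero h)
    simp only [forests, Finset.mem_filter, Finset.mem_powerset]
    exact ⟨⟨this, hg.1, ParentMap.indegree_arcSet_le_one g⟩, hg.2⟩
  · intro g _ _ g' _ _ h
    exact ParentMap.arcSet_injective h
  · intro F hF hw
    simp only [forests, Finset.mem_filter, Finset.mem_powerset] at hF
    obtain ⟨g, rfl⟩ := ParentMap.exists_arcSet_eq hF.1.2.2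
    exact ⟨g, by simpa using ⟨hF.1.2.1, hF.2⟩, hw, rfl⟩
  · intro g _ _
    rfl

lemma det_sum_smul (c : V → Option V → ℝ) (r : V → Option V → V → ℝ) :
    Matrix.det (Matrix.of fun i => ∑ o, c i o • r i o) =
      ∑ g : V → Option V, (∏ i, c i (g i)) * Matrix.det (Matrix.of fun i => r i (g i)) := by
  have h := (Matrix.detRowAlternating (n := V) (R := ℝ)).toMultilinearMap.map_sum
    (fun i o => c i o • r i o)
  simp only [MultilinearMap.map_smul_univ] at h
  exact h

/-- The matrix forest theorem, for the determinant. -/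
theorem det_one_add_kirchhoff (G : WeightedDigraph V) :
    (1 + G.kirchhoff).det = G.totalWeight G.forests := by
  classical
  have h : (1 + G.kirchhoff) =
      Matrix.of fun i => ∑ o, G.parentWeight i o • ParentMap.row i o := by
    funext i
    exact G.one_add_kirchhoff_row i
  rw [h, det_sum_smul]
  have := G.sum_parentWeight fun _ => True
  simp only [and_true, Finset.filter_true] at this
  rw [← this]
  exact Finset.sum_congr rfl fun g _ => congrArg _ (ParentMap.det_matrix g)

open Classical in
/-- The matrix forest theorem, for the adjugate. -/
theorem adjugate_one_add_kirchhoff (G : WeightedDigraph V) (i j : V) :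
    (1 + G.kirchhoff).adjugate i j =
      G.totalWeight (G.forests.filter fun F => ArcSet.InTreeDivergingFrom F j i) := by
  -- Row `j` is replaced by a single basis vector, attached to the choice `none`; this forces `j` to
  -- be a root.
  let c : V → Option V → ℝ := fun k o =>
    if k = j then o.elim 1 (fun _ => 0) else G.parentWeight k o
  let r : V → Option V → V → ℝ := fun k o => if k = j then Pi.single i 1 else ParentMap.row k o
  have h : (1 + G.kirchhoff).updateRow j (Pi.single i 1) =
      Matrix.of fun k => ∑ o, c k o • r k o := by
    funext k
    change _ = ∑ o, c k o • r k o
    by_cases hk : k = j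
    · subst hk
      funext l
      simp [c, r, Fintype.sum_option]
    · rw [Matrix.updateRow_ne hk, one_add_kirchhoff_row]
      simp [c, r, hk]
  rw [Matrix.adjugate_apply, h, det_sum_smul, ← sum_parentWeight]
  refine Finset.sum_congr rfl fun g _ => ?_
  by_cases hg : g j = none
  · have hc : ∏ k, c k (g k) = ∏ k, G.parentWeight k (g k) := by
      refine Finset.prod_congr rfl fun k _ => ?_
      by_cases hk : k = j
      · subst hk
        simp [c, hg, parentWeight]
      · simp [c, hk]
    have hr : (Matrix.of fun k => r k (g k)) =
        (ParentMap.matrix g).updateRow j (Pi.single i 1) := by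
      funext k
      by_cases hk : k = j
      · subst hk
        rw [Matrix.updateRow_self]
        exact if_pos rfl
      · rw [Matrix.updateRow_ne hk]
        exact if_neg hk
    rw [hc, hr, ← Matrix.adjugate_apply, ParentMap.adjugate_matrix hg]
    simp [ArcSet.InTreeDivergingFrom, ParentMap.isRoot_arcSet, hg]
  · have hc : ∏ k, c k (g k) = 0 := by
      refine Finset.prod_eq_zero (Finset.mem_univ j) ?_
      obtain ⟨a, ha⟩ := Option.ne_none_iff_exists'.1 hg
      simp [c, ha]
    rw [hc]
    simp [ArcSet.InTreeDivergingFrom, ParentMap.isRoot_arcSet, hg]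

/-! ### Scaled weights and unit weights -/

/-- All arc weights are multiplied by `t`. -/
def scale (G : WeightedDigraph V) (t : ℝ) (ht : 0 ≤ t) : WeightedDigraph V where
  weight i j := t * G.weight i j
  weight_nonneg i j := mul_nonneg ht (G.weight_nonneg i j)
  weight_self i := by rw [G.weight_self, mul_zero]

lemma kirchhoff_scale (G : WeightedDigraph V) (t : ℝ) (ht : 0 ≤ t) :
    (G.scale t ht).kirchhoff = t • G.kirchhoff := by
  ext i j
  simp only [kirchhoff, scale, Matrix.of_apply, Matrix.smul_apply, smul_eq_mul, mul_ite,
    Finset.mul_sum, mul_neg]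

lemma forests_scale (G : WeightedDigraph V) (t : ℝ) (ht : 0 < t) :
    (G.scale t ht.le).forests = G.forests := by
  have : (G.scale t ht.le).arcs = G.arcs := by
    ext e
    simp [mem_arcs, scale, ht.ne']
  rw [forests, forests, this]

lemma subgraphWeight_scale {V : Type*} (G : WeightedDigraph V) (t : ℝ) (ht : 0 ≤ t) (F : Finset (V × V)) :
    (G.scale t ht).subgraphWeight F = t ^ F.card * G.subgraphWeight F := by
  simp [subgraphWeight, scale, Finset.prod_mul_distrib]

lemma subgraphWeight_eq_one (G : WeightedDigraph V)
    (hunit : ∀ i j : V, G.IsArc i j → G.weight i j = 1) {F : Finset (V × V)}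
    (hF : F ∈ G.forests) : G.subgraphWeight F = 1 := by
  simp only [forests, Finset.mem_filter, Finset.mem_powerset] at hF
  refine Finset.prod_eq_one fun e he => hunit _ _ ?_
  exact (G.mem_arcs e).1 (hF.1 he)

lemma totalWeight_eq_card (G : WeightedDigraph V)
    (hunit : ∀ i j : V, G.IsArc i j → G.weight i j = 1) {S : Finset (Finset (V × V))}
    (hS : S ⊆ G.forests) : G.totalWeight S = S.card := by
  rw [totalWeight, Finset.sum_congr rfl fun F hF => G.subgraphWeight_eq_one hunit (hS hF)]
  simp

lemma totalWeight_scale (G : WeightedDigraph V)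
    (hunit : ∀ i j : V, G.IsArc i j → G.weight i j = 1) (t : ℝ) (ht : 0 ≤ t)
    {S : Finset (Finset (V × V))} (hS : S ⊆ G.forests) :
    (G.scale t ht).totalWeight S = ∑ F ∈ S, t ^ F.card := by
  refine Finset.sum_congr rfl fun F hF => ?_
  rw [subgraphWeight_scale, G.subgraphWeight_eq_one hunit (hS hF), mul_one]

lemma empty_mem_forests (G : WeightedDigraph V) : ∅ ∈ G.forests := by
  simp only [forests, Finset.mem_filter, Finset.mem_powerset]
  refine ⟨Finset.empty_subset _, fun w hw => ?_, fun w => by simp [ArcSet.indegree]⟩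
  rw [Relation.TransGen.tail'_iff] at hw
  simp at hw

lemma singleton_mem_forests (G : WeightedDigraph V) {i j : V} (h : G.IsArc i j) :
    {(i, j)} ∈ G.forests := by
  have hij : i ≠ j := by
    rintro rfl
    exact h (G.weight_self i)
  simp only [forests, Finset.mem_filter, Finset.mem_powerset]
  refine ⟨Finset.singleton_subset_iff.2 ((G.mem_arcs _).2 h), fun w hw => ?_, fun w => ?_⟩
  · obtain ⟨d, -, hd⟩ := Relation.TransGen.tail'_iff.1 hw
    obtain ⟨e, he, -⟩ := Relation.TransGen.head'_iff.1 hw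
    simp only [Finset.mem_singleton, Prod.mk.injEq] at hd he
    exact hij (he.1.symm.trans hd.2)
  · exact (Finset.card_filter_le _ _).trans (by simp)

lemma normalizedMaxOutForestMatrix_ne_zero_iff (G : WeightedDigraph V)
    (hunit : ∀ i j : V, G.IsArc i j → G.weight i j = 1) (i j : V) :
    G.normalizedMaxOutForestMatrix i j ≠ 0 ↔
      ∃ F ∈ G.maxOutForests, ArcSet.InTreeDivergingFrom F j i := by
  classical
  have hsub : G.maxOutForests ⊆ G.forests := Finset.filter_subset _ _
  rw [normalizedMaxOutForestMatrix, Matrix.smul_apply, maxOutForestMatrix, Matrix.of_apply,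
    totalWeight_eq_card G hunit hsub,
    totalWeight_eq_card G hunit ((Finset.filter_subset _ _).trans hsub), smul_eq_mul,
    mul_ne_zero_iff, ne_eq, inv_eq_zero, ← ne_eq, Nat.cast_ne_zero, Nat.cast_ne_zero, Finset.card_ne_zero,
    Finset.card_ne_zero, Finset.filter_nonempty_iff]
  exact ⟨fun h => h.2, fun h => ⟨h.imp fun F hF => hF.1, h⟩⟩

end WeightedDigraph

/-! ### Comparison of powers of `t` -/

theorem proposition17 {V : Type*} [Fintype V] [DecidableEq V] (G : WeightedDigraph V)
    (hunit : ∀ i j : V, G.IsArc i j → G.weight i j = 1)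
    (harc : ∃ i j : V, G.IsArc i j) :
    G.totalWeight G.forests = (G.forests.card : ℝ) ∧
    (1 + G.kirchhoff).det = G.totalWeight G.forests ∧
    IsUnit (1 + (G.totalWeight G.forests) ^ 2 • G.kirchhoff) ∧
    ∀ i j : V,
      (G.totalWeight G.forests)⁻¹ <
          ((1 + (G.totalWeight G.forests) ^ 2 • G.kirchhoff)⁻¹ : Matrix V V ℝ) i j ↔
        G.normalizedMaxOutForestMatrix i j ≠ 0 := by
  classical
  obtain ⟨p, q, hpq⟩ := harc
  have hN := G.totalWeight_eq_card hunit subset_rfl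
  have hcard : 1 < G.forests.card := Finset.one_lt_card.2
    ⟨∅, G.empty_mem_forests, {(p, q)}, G.singleton_mem_forests hpq, by simp⟩
  refine ⟨hN, G.det_one_add_kirchhoff, ?_⟩
  rw [hN]
  set N : ℝ := (G.forests.card : ℝ) with hNdef
  have hN1 : 1 < N := by
    rw [hNdef]
    exact_mod_cast hcard
  have hN0 : 0 < N := by linarith
  -- One factor `N` pays for the threshold `1 / N`, the other for the number of forests in the
  -- numerator.
  set t : ℝ := N ^ 2 with htdef
  have ht1 : 1 < t := one_lt_pow₀ hN1 two_ne_zero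
  have ht0 : 0 < t := by linarith
  have hdet : (1 + t • G.kirchhoff).det = ∑ F ∈ G.forests, t ^ F.card := by
    rw [← G.kirchhoff_scale t ht0.le, WeightedDigraph.det_one_add_kirchhoff,
      G.forests_scale t ht0, G.totalWeight_scale hunit t ht0.le subset_rfl]
  have hpos : 0 < ∑ F ∈ G.forests, t ^ F.card :=
    Finset.sum_pos (fun F _ => pow_pos ht0 _) ⟨∅, G.empty_mem_forests⟩
  refine ⟨(Matrix.isUnit_iff_isUnit_det _).2 (by rw [hdet]; exact hpos.ne'.isUnit), fun i j => ?_⟩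
  have hadj : (1 + t • G.kirchhoff).adjugate i j =
      ∑ F ∈ G.forests.filter (fun F => ArcSet.InTreeDivergingFrom F j i), t ^ F.card := by
    rw [← G.kirchhoff_scale t ht0.le, WeightedDigraph.adjugate_one_add_kirchhoff,
      G.forests_scale t ht0, G.totalWeight_scale hunit t ht0.le (Finset.filter_subset _ _)]
  -- With denominators cleared, the inequality reads: determinant `< N *` adjugate entry.
  rw [G.normalizedMaxOutForestMatrix_ne_zero_iff hunit, Matrix.inv_def, Matrix.smul_apply, hdet,
    hadj, Ring.inverse_eq_inv', smul_eq_mul, inv_mul_eq_div, lt_div_iff₀ hpos, inv_mul_lt_iff₀ hN0]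
  constructor
  · intro hlt
    by_contra! hno
    obtain ⟨M, hM, hmax⟩ := G.forests.exists_max_image Finset.card ⟨∅, G.empty_mem_forests⟩
    refine absurd hlt (not_lt.2 ?_)
    -- An arc exists, so the truncated subtraction in `M.card - 1` is genuine.
    have hm : 1 ≤ M.card := by simpa using hmax _ (G.singleton_mem_forests hpq)
    have hle : ∑ F ∈ G.forests.filter (fun F => ArcSet.InTreeDivergingFrom F j i), t ^ F.card ≤
        N * t ^ (M.card - 1) := by
      calc _ ≤ ∑ F ∈ G.forests.filter (fun F => ArcSet.InTreeDivergingFrom F j i),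
              t ^ (M.card - 1) := by
            refine Finset.sum_le_sum fun F hF => pow_le_pow_right₀ ht1.le ?_
            rw [Finset.mem_filter] at hF
            have hlt : F.card ≠ M.card := by
              intro h
              refine hno F ?_ hF.2
              rw [WeightedDigraph.maxOutForests, Finset.mem_filter]
              exact ⟨hF.1, fun F' hF' => h ▸ hmax F' hF'⟩
            have := hmax F hF.1
            omega
        _ ≤ _ := by
            rw [Finset.sum_const, nsmul_eq_mul, hNdef]
            gcongr
            exact Finset.filter_subset _ _
    calc _ ≤ N * (N * t ^ (M.card - 1)) := by gcongr
      _ = t ^ M.card := by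
          obtain ⟨m, hm'⟩ := Nat.exists_eq_add_of_le hm
          rw [hm', Nat.add_sub_cancel_left, pow_add, pow_one]
          nth_rewrite 2 [htdef]
          ring
      _ ≤ _ := Finset.single_le_sum (f := fun F : Finset (V × V) => t ^ F.card)
          (fun F _ => (pow_pos ht0 _).le) hM
  · rintro ⟨M, hM, hji⟩
    rw [WeightedDigraph.maxOutForests, Finset.mem_filter] at hM
    obtain ⟨hM, hmax⟩ := hM
    have hm : 1 ≤ M.card := by simpa using hmax _ (G.singleton_mem_forests hpq)
    -- Strictness comes from the empty forest, which contributes `1 < t ^ M.card`.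
    calc ∑ F ∈ G.forests, t ^ F.card < ∑ F ∈ G.forests, t ^ M.card := by
          refine Finset.sum_lt_sum (fun F hF => pow_le_pow_right₀ ht1.le (hmax F hF))
            ⟨∅, G.empty_mem_forests, ?_⟩
          simpa using one_lt_pow₀ ht1 (by omega : M.card ≠ 0)
      _ = N * t ^ M.card := by rw [Finset.sum_const, nsmul_eq_mul]
      _ ≤ _ := by
          gcongr
          exact Finset.single_le_sum (f := fun F : Finset (V × V) => t ^ F.card)
            (fun F _ => (pow_pos ht0 _).le) (Finset.mem_filter.2 ⟨hM, hji⟩)
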